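/- Let $m_2<m_1$ be nonnegative integers, $n=m_1+m_2+1$, and let $a,b>0$ be real. For $p\in\mathbb{R}$ put $f_p(x)=x^p$ if $p\notin\{0,1,\dots,n\}$ and $f_p(x)=x^p\log x$ if $p\in\{0,1,\dots,n\}$ ($x>0$). For $a\neq b$ let $P_p$ and $Q_p$ be the Hermite interpolants to $f_p$, that is, the polynomials of degree at most $n$ with $$P_p^{(j)}(a)=f_p^{(j)}(a)\ (0\le j\le m_1),\qquad P_p^{(j)}(b)=f_p^{(j)}(b)\ (0\le j\le m_2),$$ $$Q_p^{(j)}(a)=f_p^{(j)}(a)\ (0\le j\le m_2),\qquad Q_p^{(j)}(b)=f_p^{(j)}(b)\ (0\le j\le m_1).$$ The power mean $M_{p,m_1,m_2}(a,b)$ is defined as the point $x$ strictly between $a$ and $b$ with $P_p(x)=Q_p(x)$ if $m_1-m_2$ is even, and with $f_p(x)=\tfrac12\left(P_p(x)+Q_p(x)\right)$ if $m_1-m_2$ is odd; moreover $M_{p,m_1,m_2}(a,a)=a$. Then, for fixed $m_1,m_2,a,b$, the function $p\mapsto M_{p,m_1,m_2}(a,b)$ is nondecreasing on $\mathbb{R}$.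 If $a\neq b$, then for every real $p$ the point $x$ defining $M_{p,m_1,m_2}(a,b)$ exists and is unique, and $p\mapsto M_{p,m_1,m_2}(a,b)$ is strictly increasing on $\mathbb{R}$. -/

import Mathlib

/-- `P` is a real polynomial of degree at most `r + s + 1` that agrees with `f` at `a` up to the
derivative of order `r`, and at `b` up to the derivative of order `s`
(the Hermite interpolant to `f` when `a ≠ b`). -/
def IsHermiteInterpolant (f : ℝ → ℝ) (a b : ℝ) (r s : ℕ) (P : Polynomial ℝ) : Prop :=
  P.natDegree ≤ r + s + 1 ∧
  (∀ j ≤ r, (Polynomial.derivative^[j] P).eval a = iteratedDeriv j f a) ∧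
  (∀ j ≤ s, (Polynomial.derivative^[j] P).eval b = iteratedDeriv j f b)

/-- `x` lies strictly between `a` and `b`, and, for the two Hermite interpolants `P` (orders
`m₁` at `a`, `m₂` at `b`) and `Q` (orders `m₂` at `a`, `m₁` at `b`) to `f`, it solves
`P x = Q x` if `m₁ - m₂` is even, and `f x = (P x + Q x) / 2` if `m₁ - m₂` is odd.
The condition is symmetric in `a` and `b`, which exchanges `P` and `Q`. -/
def IsHermiteMeanPoint (f : ℝ → ℝ) (m₁ m₂ : ℕ) (a b x : ℝ) : Prop :=
  x ∈ Set.Ioo (min a b) (max a b) ∧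
  ∃ P Q : Polynomial ℝ,
    IsHermiteInterpolant f a b m₁ m₂ P ∧ IsHermiteInterpolant f a b m₂ m₁ Q ∧
    (Even (m₁ - m₂) → P.eval x = Q.eval x) ∧
    (Odd (m₁ - m₂) → f x = (P.eval x + Q.eval x) / 2)

open Classical in
/-- The mean `M_{f,m₁,m₂}(a,b)`: the point singled out by `IsHermiteMeanPoint` if `a ≠ b`,
and the common value if `a = b`. -/
noncomputable def hermiteMean (f : ℝ → ℝ) (m₁ m₂ : ℕ) (a b : ℝ) : ℝ :=
  if a = b then a else Classical.epsilon (IsHermiteMeanPoint f m₁ m₂ a b)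

open Classical in
/-- The function generating the power mean of exponent `p`: it is `x ^ p`, except for
`p ∈ {0, 1, ..., n}`, where it is `x ^ p * log x`. -/
noncomputable def powerGenerator (n : ℕ) (p : ℝ) (x : ℝ) : ℝ :=
  if ∃ k : ℕ, k ≤ n ∧ p = k then x ^ p * Real.log x else x ^ p

/-- The power mean `M_{p,m₁,m₂}(a,b)`, for every real `p`. -/
noncomputable def powerMean (p : ℝ) (m₁ m₂ : ℕ) (a b : ℝ) : ℝ :=
  hermiteMean (powerGenerator (m₁ + m₂ + 1) p) m₁ m₂ a b

/-! Write `k = m₁ - m₂`, `s = m₂`. Both parity cases say that `(f - P)(x) - (-1)^k (f - Q)(x) = 0`.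
For `a < b`, the integral form of the interpolation error (`IsHermiteInterpolant.error_eq`), with
kernels rewritten as incomplete beta integrals, turns the left side into a nonzero factor times `∫
K(x,t) w(t) dt` over `[a,b]`, where `f^(n+1) = c w` (`hermite_error_sub_error_eq`). For the power
generators `w(t) = t^(p-n-1)` and `c ≠ 0`.

The kernel `K` (`hermiteKernel`) is positive for `t < x`, negative for `t > x` and, after a suitable
normalization, nondecreasing in `x` (`hermiteKernel_mono`). So for `w > 0` the integral is strictly
increasing in `x`. It takes both signs, hence has exactly one zero.

Passing from `p` to `q > p` multiplies `w` by the increasing function `φ(t) = t^(q-p)`. At the zero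
`x` for `p`, `∫ K w φ = ∫ K w (φ - φ(x)) < 0`, because `K` and `φ - φ(x)` have opposite signs
(`integral_hermiteKernel_mul_neg`). Monotonicity in `x` then puts the zero for `q` to the right of
`x`. The case `a > b` follows by symmetry. -/

open Polynomial

/-! ### Existence and symmetry of Hermite interpolants. -/

/-- A polynomial divisible by `(X - a) ^ r` has vanishing derivatives of order less than `r`
at `a`. -/
theorem eval_iterate_derivative_eq_zero_of_pow_dvd {a : ℝ} {r i : ℕ} {p : ℝ[X]}
    (h : (X - C a) ^ r ∣ p) (hi : i < r) : (derivative^[i] p).eval a = 0 := by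
  have h1 := pow_sub_dvd_iterate_derivative_of_pow_dvd i h
  have h2 : (X - C a) ∣ derivative^[i] p := (dvd_pow_self _ (by omega)).trans h1
  exact dvd_iff_isRoot.mp h2

theorem eval_iterate_derivative_X_sub_C_pow_mul (a : ℝ) (r : ℕ) (p : ℝ[X]) :
    (derivative^[r] ((X - C a) ^ r * p)).eval a = r.factorial * p.eval a := by
  rw [← factorial_smul_hasseDeriv, LinearMap.smul_apply, eval_smul, ← taylor_coeff, taylor_mul,
    taylor_pow]
  simp [taylor_coeff_zero, coeff_X_pow_mul']

/-- Hermite interpolation at two distinct points, with `r` conditions at `a` and `s` conditions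
at `b`. -/
theorem exists_hermite_interpolation {a b : ℝ} (hab : a ≠ b) (u v : ℕ → ℝ) (r s : ℕ) :
    ∃ P : ℝ[X], P.degree < (r + s : ℕ) ∧
      (∀ j < r, (derivative^[j] P).eval a = u j) ∧
      (∀ j < s, (derivative^[j] P).eval b = v j) := by
  -- Newton's step: a multiple of `(X - c)^r (X - d)^s` disturbs none of the conditions already met
  -- and fixes the derivative of order `r` at `c`. The nodes are generic so that the step serves at
  -- `a` and at `b`.
  have key : ∀ (c d : ℝ) (_ : c ≠ d) (u v : ℕ → ℝ) (r s : ℕ),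
      (∃ P : ℝ[X], P.degree < (r + s : ℕ) ∧
        (∀ j < r, (derivative^[j] P).eval c = u j) ∧
        (∀ j < s, (derivative^[j] P).eval d = v j)) →
      ∃ P : ℝ[X], P.degree < (r + 1 + s : ℕ) ∧
        (∀ j < r + 1, (derivative^[j] P).eval c = u j) ∧
        (∀ j < s, (derivative^[j] P).eval d = v j) := by
    rintro c d hcd u v r s ⟨P, hdeg, hc, hd⟩
    set R : ℝ[X] := (X - C c) ^ r * (X - C d) ^ s with hR
    set e : ℝ := (u r - (derivative^[r] P).eval c) / (r.factorial * (c - d) ^ s) with he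
    have hne : (r.factorial * (c - d) ^ s : ℝ) ≠ 0 :=
      mul_ne_zero (by exact_mod_cast r.factorial_ne_zero) (pow_ne_zero _ (sub_ne_zero.mpr hcd))
    have hRdeg : R.degree = (r + s : ℕ) := by
      rw [hR, degree_mul, degree_pow, degree_pow, degree_X_sub_C, degree_X_sub_C]
      simp
    have hRc : (derivative^[r] R).eval c = r.factorial * (c - d) ^ s := by
      rw [hR, eval_iterate_derivative_X_sub_C_pow_mul]
      simp
    refine ⟨P + e • R, ?_, ?_, ?_⟩
    · refine (degree_add_le _ _).trans_lt (max_lt ?_ ?_)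
      · exact hdeg.trans (by exact_mod_cast (by omega : r + s < r + 1 + s))
      · refine (degree_smul_le _ _).trans_lt ?_
        rw [hRdeg]
        exact_mod_cast (by omega : r + s < r + 1 + s)
    · intro j hj
      rw [iterate_map_add, iterate_derivative_smul, eval_add, eval_smul, smul_eq_mul]
      rcases Nat.lt_succ_iff_lt_or_eq.mp hj with hj | rfl
      · rw [hc j hj, eval_iterate_derivative_eq_zero_of_pow_dvd (Dvd.intro _ rfl) hj]
        ring
      · rw [hRc, he, div_mul_cancel₀ _ hne]
        ring
    · intro j hj
      rw [iterate_map_add, iterate_derivative_smul, eval_add, eval_smul, smul_eq_mul, hd j hj,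
        eval_iterate_derivative_eq_zero_of_pow_dvd (Dvd.intro_left _ rfl) hj]
      ring
  induction r with
  | zero =>
    induction s with
    | zero => exact ⟨0, by simp, by simp, by simp⟩
    | succ s ih =>
      obtain ⟨P, h1, h2, h3⟩ := ih
      obtain ⟨Q, k1, k2, k3⟩ := key b a hab.symm v u s 0 ⟨P, by simpa [add_comm] using h1, h3, h2⟩
      exact ⟨Q, by simpa [add_comm] using k1, k3, k2⟩
  | succ r ih => exact key a b hab u v r s ih

theorem exists_isHermiteInterpolant (f : ℝ → ℝ) {a b : ℝ} (hab : a ≠ b) (r s : ℕ) :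
    ∃ P, IsHermiteInterpolant f a b r s P := by
  obtain ⟨P, h1, h2, h3⟩ := exists_hermite_interpolation hab (fun j => iteratedDeriv j f a)
    (fun j => iteratedDeriv j f b) (r + 1) (s + 1)
  refine ⟨P, ?_, fun j hj => h2 j (by omega), fun j hj => h3 j (by omega)⟩
  rw [natDegree_le_iff_degree_le]
  refine degree_le_of_natDegree_le ?_
  rcases eq_or_ne P 0 with rfl | hP
  · simp
  · have := (natDegree_lt_iff_degree_lt hP).mpr h1
    omega

theorem IsHermiteInterpolant.symm {f : ℝ → ℝ} {a b : ℝ} {r s : ℕ} {P : ℝ[X]}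
    (h : IsHermiteInterpolant f a b r s P) : IsHermiteInterpolant f b a s r P :=
  ⟨by have := h.1; omega, h.2.2, h.2.1⟩

theorem IsHermiteMeanPoint.symm {f : ℝ → ℝ} {m₁ m₂ : ℕ} {a b x : ℝ}
    (h : IsHermiteMeanPoint f m₁ m₂ a b x) : IsHermiteMeanPoint f m₁ m₂ b a x := by
  obtain ⟨hx, P, Q, hP, hQ, he, ho⟩ := h
  refine ⟨by rwa [min_comm, max_comm], Q, P, hQ.symm, hP.symm, fun h => (he h).symm, fun h => ?_⟩
  rw [ho h, add_comm]

theorem isHermiteMeanPoint_comm {f : ℝ → ℝ} {m₁ m₂ : ℕ} {a b x : ℝ} :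
    IsHermiteMeanPoint f m₁ m₂ a b x ↔ IsHermiteMeanPoint f m₁ m₂ b a x :=
  ⟨.symm, .symm⟩

/-! ### Integral form of the interpolation error. -/

/-- Repeated integration by parts against a polynomial of degree at most `n`, where `H j` is the
`j`-th derivative of `H 0`. -/
theorem integral_mul_polynomial_eq {n : ℕ} {c d : ℝ} {H : ℕ → ℝ → ℝ}
    (hH : ∀ j ≤ n, ∀ t ∈ Set.uIcc c d, HasDerivAt (H j) (H (j + 1) t) t)
    (hc : ContinuousOn (H (n + 1)) (Set.uIcc c d)) {U : ℝ[X]} (hU : U.natDegree ≤ n) :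
    ∫ t in c..d, H (n + 1) t * U.eval t =
      (∑ i ∈ Finset.range (n + 1), (-1) ^ i * H (n - i) d * (derivative^[i] U).eval d) -
      ∑ i ∈ Finset.range (n + 1), (-1) ^ i * H (n - i) c * (derivative^[i] U).eval c := by
  refine intervalIntegral.integral_eq_sub_of_hasDerivAt
    (f := fun t => ∑ i ∈ Finset.range (n + 1), (-1) ^ i * H (n - i) t * (derivative^[i] U).eval t)
    (fun t ht => ?_)
    (hc.mul U.continuous.continuousOn).intervalIntegrable
  -- Each derivative is written as a difference of consecutive terms, so the sum telescopes to `H (n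
  -- + 1) * U` and a term containing the derivative of `U` of order `n + 1`, which is zero.
  have hterm : ∀ i ∈ Finset.range (n + 1), HasDerivAt
      (fun t => (-1) ^ i * H (n - i) t * (derivative^[i] U).eval t)
      ((-1) ^ i * H (n + 1 - i) t * (derivative^[i] U).eval t -
        (-1) ^ (i + 1) * H (n + 1 - (i + 1)) t * (derivative^[i + 1] U).eval t) t := by
    intro i hi
    have hi : i ≤ n := Nat.lt_succ_iff.mp (Finset.mem_range.mp hi)
    have h1 := (((hH (n - i) (by omega) t ht).const_mul ((-1) ^ i))).mul
      ((derivative^[i] U).hasDerivAt t)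
    refine h1.congr_deriv ?_
    rw [show n - i + 1 = n + 1 - i by omega, show n + 1 - (i + 1) = n - i by omega,
      Function.iterate_succ_apply']
    ring
  refine (HasDerivAt.fun_sum hterm).congr_deriv ?_
  rw [Finset.sum_range_sub'
    (fun i => (-1) ^ i * H (n + 1 - i) t * (derivative^[i] U).eval t),
    iterate_derivative_eq_zero (by omega : U.natDegree < n + 1)]
  simp

/-- The part of the binomial expansion of `(A - B) ^ n` of degree at most `r` in `A`. -/
noncomputable def truncatedBinomial {R : Type*} [CommRing R] (n r : ℕ) (A B : R) : R :=
  ∑ j ∈ Finset.range (r + 1), (n.choose j : R) * A ^ j * (-B) ^ (n - j)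

/-- The terms of degree above `r` in `A` are those of degree at most `s` in `B`; reflecting the
index turns them into the truncation of `(B - A)^n`, at the cost of the sign `(-1)^n`. -/
theorem truncatedBinomial_add {R : Type*} [CommRing R] (r s : ℕ) (A B : R) :
    truncatedBinomial (r + s + 1) r A B +
      (-1) ^ (r + s + 1) * truncatedBinomial (r + s + 1) s B A = (A - B) ^ (r + s + 1) := by
  rw [sub_eq_add_neg, add_pow, Finset.range_eq_Ico,
    ← Finset.sum_Ico_consecutive _ (Nat.zero_le (r + 1)) (by omega : r + 1 ≤ r + s + 1 + 1),
    truncatedBinomial, truncatedBinomial, Finset.range_eq_Ico, Finset.range_eq_Ico]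
  congr 1
  · exact Finset.sum_congr rfl fun j _ => by ring
  · rw [Finset.mul_sum]
    have := Finset.sum_Ico_reflect (fun j => A ^ j * (-B) ^ (r + s + 1 - j) *
      ((r + s + 1).choose j : R)) 0 (m := s + 1) (n := r + s + 1) (by omega)
    rw [show r + s + 1 + 1 - (s + 1) = r + 1 by omega, Nat.sub_zero] at this
    rw [← this]
    refine Finset.sum_congr rfl fun j hj => ?_
    have hj : j ≤ s := by simpa [Nat.lt_succ_iff] using hj
    obtain ⟨e, he⟩ : ∃ e, r + s + 1 = j + e := ⟨r + s + 1 - j, by omega⟩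
    rw [Nat.choose_symm (by omega), he, Nat.add_sub_cancel_left, Nat.add_sub_cancel,
      neg_pow A, neg_pow B, pow_add]
    have : ((-1 : R) ^ e) * (-1) ^ e = 1 := by rw [← mul_pow]; simp
    linear_combination ((-1) ^ j * ((j + e).choose j : R) * B ^ j * A ^ e) * this

theorem truncatedBinomial_map {R S : Type*} [CommRing R] [CommRing S] (φ : R →+* S) (n r : ℕ)
    (A B : R) : φ (truncatedBinomial n r A B) = truncatedBinomial n r (φ A) (φ B) := by
  simp [truncatedBinomial]

theorem pow_dvd_truncatedBinomial {R : Type*} [CommRing R] (r s : ℕ) (A B : R) :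
    B ^ (s + 1) ∣ truncatedBinomial (r + s + 1) r A B := by
  refine Finset.dvd_sum fun j hj => Dvd.dvd.mul_left ?_ _
  have := Finset.mem_range.mp hj
  rw [neg_pow]
  exact (pow_dvd_pow B (by omega)).mul_left _

theorem natDegree_truncatedBinomial_le (r s : ℕ) {A B : ℝ[X]} (hA : A.natDegree ≤ 1)
    (hB : B.natDegree ≤ 1) : (truncatedBinomial (r + s + 1) r A B).natDegree ≤ r + s + 1 := by
  refine natDegree_sum_le_of_forall_le _ _ fun j hj => ?_
  have hj : j ≤ r := Nat.lt_succ_iff.mp (Finset.mem_range.mp hj)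
  refine natDegree_mul_le.trans ?_
  have h1 : (((r + s + 1).choose j : ℝ[X]) * A ^ j).natDegree ≤ j := by
    refine natDegree_mul_le.trans ?_
    rw [natDegree_natCast, zero_add]
    exact natDegree_pow_le.trans (by nlinarith)
  have h2 : ((-B) ^ (r + s + 1 - j)).natDegree ≤ r + s + 1 - j := by
    refine natDegree_pow_le.trans ?_
    rw [natDegree_neg]
    nlinarith
  omega

/-- The error of Hermite interpolation in integral form. -/
theorem IsHermiteInterpolant.error_eq {f : ℝ → ℝ} {a b x : ℝ} {r s : ℕ} {P : ℝ[X]}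
    (hP : IsHermiteInterpolant f a b r s P) (hx : x ∈ Set.Icc a b)
    (hf : ∀ j ≤ r + s + 1, ∀ t ∈ Set.Icc a b,
      HasDerivAt (iteratedDeriv j f) (iteratedDeriv (j + 1) f t) t)
    (hc : ContinuousOn (iteratedDeriv (r + s + 1 + 1) f) (Set.Icc a b)) :
    (r + s + 1).factorial * (b - a) ^ (r + s + 1) * (f x - P.eval x) =
      (∫ t in a..x, iteratedDeriv (r + s + 1 + 1) f t *
        truncatedBinomial (r + s + 1) r ((x - a) * (b - t)) ((t - a) * (b - x))) -
      ∫ t in x..b, iteratedDeriv (r + s + 1 + 1) f t * ((-1) ^ (r + s + 1) *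
        truncatedBinomial (r + s + 1) s ((t - a) * (b - x)) ((x - a) * (b - t))) := by
  set n := r + s + 1 with hn
  set α : ℝ[X] := C (x - a) * (C b - X) with hα
  set β : ℝ[X] := C (b - x) * (X - C a) with hβ
  have hα1 : α.natDegree ≤ 1 := by rw [hα]; compute_degree
  have hβ1 : β.natDegree ≤ 1 := by rw [hβ]; compute_degree
  set U : ℝ[X] := truncatedBinomial n r α β with hU
  set V : ℝ[X] := (-1) ^ n * truncatedBinomial n s β α with hV
  have hUdeg : U.natDegree ≤ n := natDegree_truncatedBinomial_le r s hα1 hβ1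
  have hVdeg : V.natDegree ≤ n := by
    have h1 : (truncatedBinomial n s β α).natDegree ≤ n := by
      have := natDegree_truncatedBinomial_le s r hβ1 hα1
      rwa [add_comm s r] at this
    have h2 : V = C ((-1) ^ n) * truncatedBinomial n s β α := by simp [hV]
    rw [h2]
    exact (natDegree_C_mul_le _ _).trans h1
  have hUa : ∀ i ≤ s, (derivative^[i] U).eval a = 0 := fun i hi => by
    refine eval_iterate_derivative_eq_zero_of_pow_dvd (r := s + 1) ?_ (by omega)
    refine Dvd.dvd.trans ?_ (pow_dvd_truncatedBinomial r s α β)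
    exact pow_dvd_pow_of_dvd (Dvd.intro_left _ rfl) _
  have hVb : ∀ i ≤ r, (derivative^[i] V).eval b = 0 := fun i hi => by
    refine eval_iterate_derivative_eq_zero_of_pow_dvd (r := r + 1) ?_ (by omega)
    refine Dvd.dvd.mul_left (Dvd.dvd.trans ?_ (?_ : α ^ (r + 1) ∣ _)) _
    · refine pow_dvd_pow_of_dvd (Dvd.dvd.mul_left ?_ _) _
      rw [← neg_sub, neg_dvd]
    · rw [hn, add_comm r s]
      exact pow_dvd_truncatedBinomial s r β α
  have hUV : U + V = C ((a - b) ^ n) * (X - C x) ^ n := by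
    rw [hU, hV, hn, truncatedBinomial_add, C_pow, ← mul_pow]
    congr 1
    simp only [hα, hβ, C_sub]
    ring
  set H : ℕ → ℝ → ℝ := fun j t => iteratedDeriv j f t - (derivative^[j] P).eval t with hH
  have hHd : ∀ j ≤ n, ∀ t ∈ Set.Icc a b, HasDerivAt (H j) (H (j + 1) t) t := fun j hj t ht => by
    have := (hf j hj t ht).sub ((derivative^[j] P).hasDerivAt t)
    rwa [← Function.iterate_succ_apply' (f := derivative)] at this
  have hHn : H (n + 1) = iteratedDeriv (n + 1) f := by
    funext t
    simp only [hH]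
    rw [iterate_derivative_eq_zero (by have := hP.1; omega : P.natDegree < n + 1)]
    simp
  have hHa : ∀ j ≤ r, H j a = 0 := fun j hj => by simp [hH, hP.2.1 j hj]
  have hHb : ∀ j ≤ s, H j b = 0 := fun j hj => by simp [hH, hP.2.2 j hj]
  have hax : Set.uIcc a x ⊆ Set.Icc a b := by
    rw [Set.uIcc_of_le hx.1]; exact Set.Icc_subset_Icc_right hx.2
  have hxb : Set.uIcc x b ⊆ Set.Icc a b := by
    rw [Set.uIcc_of_le hx.2]; exact Set.Icc_subset_Icc_left hx.1
  have e1 := integral_mul_polynomial_eq (fun j hj t ht => hHd j hj t (hax ht))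
    (by rw [hHn]; exact hc.mono hax) hUdeg
  have e2 := integral_mul_polynomial_eq (fun j hj t ht => hHd j hj t (hxb ht))
    (by rw [hHn]; exact hc.mono hxb) hVdeg
  -- For `i ≤ s` the factor from `U` vanishes; for `i > s`, `n - i ≤ r` and the interpolation
  -- conditions apply. The other endpoint is the mirror image.
  have z1 : ∑ i ∈ Finset.range (n + 1), (-1) ^ i * H (n - i) a * (derivative^[i] U).eval a = 0 := by
    refine Finset.sum_eq_zero fun i _ => ?_
    rcases le_or_gt i s with h | h
    · rw [hUa i h, mul_zero]
    · rw [hHa _ (by omega), mul_zero, zero_mul]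
  have z2 : ∑ i ∈ Finset.range (n + 1), (-1) ^ i * H (n - i) b * (derivative^[i] V).eval b = 0 := by
    refine Finset.sum_eq_zero fun i _ => ?_
    rcases le_or_gt i r with h | h
    · rw [hVb i h, mul_zero]
    · rw [hHb _ (by omega), mul_zero, zero_mul]
  -- The boundary terms at `x` involve only `U + V`, a multiple of `(X - x)^n`, so just `i = n`
  -- survives and yields the error itself.
  have z3 : (∑ i ∈ Finset.range (n + 1), (-1) ^ i * H (n - i) x * (derivative^[i] U).eval x) +
      ∑ i ∈ Finset.range (n + 1), (-1) ^ i * H (n - i) x * (derivative^[i] V).eval x =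
      n.factorial * (b - a) ^ n * (f x - P.eval x) := by
    rw [← Finset.sum_add_distrib]
    have : ∀ i, (-1) ^ i * H (n - i) x * (derivative^[i] U).eval x +
        (-1) ^ i * H (n - i) x * (derivative^[i] V).eval x =
        (-1) ^ i * H (n - i) x * ((a - b) ^ n * (derivative^[i] ((X - C x) ^ n)).eval x) := by
      intro i
      rw [← mul_add, ← eval_add, ← iterate_map_add, hUV, iterate_derivative_C_mul, eval_mul, eval_C]
    simp only [this]
    rw [Finset.sum_range_succ, Finset.sum_eq_zero, iterate_derivative_X_sub_pow_self]
    · simp only [hH, Nat.sub_self, iteratedDeriv_zero, Function.iterate_zero, id, eval_natCast]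
      rw [← neg_sub b a, neg_pow (b - a)]
      have : ((-1 : ℝ) ^ n) * (-1) ^ n = 1 := by rw [← mul_pow]; simp
      linear_combination ((f x - P.eval x) * (b - a) ^ n * n.factorial) * this
    · intro i hi
      rw [eval_iterate_derivative_eq_zero_of_pow_dvd dvd_rfl (Finset.mem_range.mp hi)]
      ring
  have evU : ∀ t, U.eval t = truncatedBinomial n r ((x - a) * (b - t)) ((t - a) * (b - x)) := by
    intro t
    rw [hU, ← coe_evalRingHom, truncatedBinomial_map]
    simp [hα, hβ, mul_comm]
  have evV : ∀ t, V.eval t =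
      (-1) ^ n * truncatedBinomial n s ((t - a) * (b - x)) ((x - a) * (b - t)) := by
    intro t
    rw [hV, ← coe_evalRingHom, map_mul, truncatedBinomial_map]
    simp [hα, hβ, mul_comm]
  simp only [hHn, evU, evV] at e1 e2
  rw [e1, e2, ← z3, z1, z2]
  ring

/-! ### Incomplete beta integrals and their differences. -/

/-- Truncated binomial expansions as incomplete beta integrals. -/
theorem truncatedBinomial_eq_integral (r s : ℕ) (A B : ℝ) :
    r.factorial * s.factorial * truncatedBinomial (r + s + 1) r A B =
      (-1) ^ (s + 1) * (r + s + 1).factorial *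
        (B ^ (s + 1) * ∫ v in (0 : ℝ)..1, v ^ s * (A - B * (1 - v)) ^ r) := by
  set n := r + s + 1 with hn
  set z := A - B with hz
  -- Along the line of constant difference `A - B = z` the derivative telescopes to one monomial.
  -- The value at `u = 0` is zero, so integrating up to `u = B` and substituting `u = v B` gives the
  -- formula.
  have hder : ∀ u : ℝ, HasDerivAt (fun u => truncatedBinomial n r (z + u) u)
      (-((s + 1) * n.choose r * (z + u) ^ r * (-u) ^ s)) u := by
    intro u
    have hterm : ∀ j ∈ Finset.range (r + 1), HasDerivAt
        (fun u => (n.choose j : ℝ) * (z + u) ^ j * (-u) ^ (n - j))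
        (j * n.choose j * (z + u) ^ (j - 1) * (-u) ^ (n - j) -
          (j + 1 : ℕ) * n.choose (j + 1) * (z + u) ^ (j + 1 - 1) * (-u) ^ (n - (j + 1))) u := by
      intro j hj
      have hj : j ≤ r := Nat.lt_succ_iff.mp (Finset.mem_range.mp hj)
      have h1 := ((((hasDerivAt_id u).const_add z).pow j).const_mul (n.choose j : ℝ)).mul
        ((hasDerivAt_id u).neg.pow (n - j))
      refine h1.congr_deriv ?_
      have hch : (n.choose (j + 1) : ℝ) * (j + 1 : ℕ) = n.choose j * (n - j : ℕ) := by
        exact_mod_cast Nat.choose_succ_right_eq n j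
      simp only [Pi.pow_apply, Pi.neg_apply, id, Nat.add_sub_cancel,
        show n - (j + 1) = n - j - 1 by omega]
      linear_combination ((z + u) ^ j * (-u) ^ (n - j - 1)) * hch
    refine (HasDerivAt.fun_sum hterm).congr_deriv ?_
    rw [Finset.sum_range_sub'
      (fun j : ℕ => (j : ℝ) * n.choose j * (z + u) ^ (j - 1) * (-u) ^ (n - j))]
    have hch : (n.choose (r + 1) : ℝ) * (r + 1 : ℕ) = n.choose r * (s + 1 : ℕ) := by
      have := Nat.choose_succ_right_eq n r
      rw [show n - r = s + 1 by omega] at this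
      exact_mod_cast this
    rw [show n - (r + 1) = s by omega, Nat.add_sub_cancel]
    push_cast at hch ⊢
    linear_combination (-((z + u) ^ r * (-u) ^ s)) * hch
  have hint := intervalIntegral.integral_eq_sub_of_hasDerivAt (a := 0) (b := B)
    (fun u _ => hder u) (Continuous.intervalIntegrable (by fun_prop) _ _)
  have h0 : truncatedBinomial n r (z + 0) 0 = 0 := by
    have := pow_dvd_truncatedBinomial r s (z + 0) (0 : ℝ)
    simpa using this
  rw [h0, sub_zero, show z + B = A by rw [hz]; ring] at hint
  have hsub := intervalIntegral.mul_integral_comp_mul_right (a := 0) (b := 1)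
    (f := fun u : ℝ => -((s + 1) * n.choose r * (z + u) ^ r * (-u) ^ s)) B
  rw [zero_mul, one_mul, hint] at hsub
  have hfac : (n.choose r : ℝ) * r.factorial * ((s + 1) * s.factorial) = n.factorial := by
    have := Nat.choose_mul_factorial_mul_factorial (n := n) (k := r) (by omega)
    rw [show n - r = s + 1 by omega, Nat.factorial_succ] at this
    exact_mod_cast this
  have hI : (∫ v in (0 : ℝ)..1, -((s + 1) * n.choose r * (z + v * B) ^ r * (-(v * B)) ^ s)) =
      (-1) ^ (s + 1) * ((s + 1) * n.choose r) * B ^ s *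
        ∫ v in (0 : ℝ)..1, v ^ s * (A - B * (1 - v)) ^ r := by
    rw [← intervalIntegral.integral_const_mul]
    refine intervalIntegral.integral_congr fun v _ => ?_
    rw [show z + v * B = A - B * (1 - v) by rw [hz]; ring, neg_pow, mul_pow]
    ring
  rw [← hsub, hI, ← hfac]
  ring

/-- A homogeneous incomplete beta integral. -/
noncomputable def betaKernel (r s : ℕ) (A B : ℝ) : ℝ :=
  B ^ (s + 1) * ∫ v in (0 : ℝ)..1, v ^ s * (A - B * (1 - v)) ^ r

/-- The cofactor of `B ^ (s + 1)` in `betaKernel (s + k) s A B - betaKernel s (s + k) A B`. -/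
noncomputable def betaDiff (s k : ℕ) (A B : ℝ) : ℝ :=
  ∫ v in (0 : ℝ)..1, v ^ s * (A - B * (1 - v)) ^ s * ((A - B * (1 - v)) ^ k - (B * v) ^ k)

theorem continuous_betaKernel (r s : ℕ) :
    Continuous fun z : ℝ × ℝ => betaKernel r s z.1 z.2 := by
  refine (continuous_snd.pow _).mul ?_
  refine intervalIntegral.continuous_parametric_intervalIntegral_of_continuous'
    (f := fun (z : ℝ × ℝ) (v : ℝ) => v ^ s * (z.1 - z.2 * (1 - v)) ^ r) ?_ 0 1
  simp only [Function.uncurry_def]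
  fun_prop

theorem continuous_betaDiff (s k : ℕ) :
    Continuous fun z : ℝ × ℝ => betaDiff s k z.1 z.2 := by
  refine intervalIntegral.continuous_parametric_intervalIntegral_of_continuous'
    (f := fun (z : ℝ × ℝ) (v : ℝ) => v ^ s * (z.1 - z.2 * (1 - v)) ^ s *
      ((z.1 - z.2 * (1 - v)) ^ k - (z.2 * v) ^ k)) ?_ 0 1
  simp only [Function.uncurry_def]
  fun_prop

theorem betaKernel_sub_betaKernel (s k : ℕ) (A B : ℝ) :
    betaKernel (s + k) s A B - betaKernel s (s + k) A B = B ^ (s + 1) * betaDiff s k A B := by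
  have h : B ^ (s + k + 1) * (∫ v in (0 : ℝ)..1, v ^ (s + k) * (A - B * (1 - v)) ^ s) =
      B ^ (s + 1) * ∫ v in (0 : ℝ)..1, B ^ k * (v ^ (s + k) * (A - B * (1 - v)) ^ s) := by
    rw [intervalIntegral.integral_const_mul]
    ring
  rw [betaKernel, betaKernel, h, ← mul_sub, ← intervalIntegral.integral_sub]
  · congr 1
    refine intervalIntegral.integral_congr fun v _ => ?_
    simp only [pow_add, mul_pow]
    ring
  all_goals exact Continuous.intervalIntegrable (by fun_prop) _ _

theorem betaDiff_smul (s k : ℕ) (c A B : ℝ) :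
    betaDiff s k (c * A) (c * B) = c ^ (s + k) * betaDiff s k A B := by
  rw [betaDiff, betaDiff, ← intervalIntegral.integral_const_mul]
  refine intervalIntegral.integral_congr fun v _ => ?_
  simp only [show c * A - c * B * (1 - v) = c * (A - B * (1 - v)) by ring,
    show c * B * v = c * (B * v) by ring, mul_pow c, pow_add]
  ring

theorem betaDiff_self (s k : ℕ) (A : ℝ) : betaDiff s k A A = 0 := by
  refine intervalIntegral.integral_zero_ae (Filter.Eventually.of_forall fun v _ => ?_)
  simp only [show A - A * (1 - v) = A * v by ring]
  ring

/-- The two bases in the last factor satisfy `A - B (1 - v) - B v = A - B`, so the integrand is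
nonnegative; it is positive at `v = 1`. -/
theorem betaDiff_pos (s : ℕ) {k : ℕ} (hk : k ≠ 0) {A B : ℝ} (hB : 0 ≤ B) (hAB : B < A) :
    0 < betaDiff s k A B := by
  refine intervalIntegral.integral_pos one_pos (Continuous.continuousOn (by fun_prop))
    (fun v hv => ?_) ⟨1, by simp, ?_⟩
  · have h1 : 0 ≤ B * v := mul_nonneg hB hv.1.le
    have h2 : B * v ≤ A - B * (1 - v) := by linarith
    exact mul_nonneg (mul_nonneg (pow_nonneg hv.1.le _) (pow_nonneg (h1.trans h2) _))
      (sub_nonneg.mpr (pow_le_pow_left₀ h1 h2 _))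
  · have h1 : B ^ k < A ^ k := pow_lt_pow_left₀ hAB hB hk
    have h2 : 0 < A ^ s := pow_pos (hB.trans_lt hAB) _
    simpa using mul_pos h2 (sub_pos.mpr h1)

/-- Pointwise in `v`: as `B` grows, `A - B (1 - v)` decreases and `B v` increases, both remaining
nonnegative as long as `B ≤ A`. -/
theorem betaDiff_le_betaDiff_of_le_right (s k : ℕ) {A B B' : ℝ} (hB : 0 ≤ B) (hBB : B ≤ B')
    (hBA : B' ≤ A) : betaDiff s k A B' ≤ betaDiff s k A B := by
  refine intervalIntegral.integral_mono_on zero_le_one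
    (Continuous.intervalIntegrable (by fun_prop) _ _)
    (Continuous.intervalIntegrable (by fun_prop) _ _) fun v hv => ?_
  have h0 : B * v ≤ B' * v := mul_le_mul_of_nonneg_right hBB hv.1
  have h1 : 0 ≤ B * v := mul_nonneg hB hv.1
  have h2 : B' * v ≤ A - B' * (1 - v) := by linarith
  have h3 : A - B' * (1 - v) ≤ A - B * (1 - v) := by
    have := mul_le_mul_of_nonneg_right hBB (sub_nonneg.mpr hv.2)
    linarith
  have h4 : 0 ≤ A - B' * (1 - v) := h1.trans (h0.trans h2)
  have h5 := pow_le_pow_left₀ (h1.trans h0) h2 k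
  have h6 : 0 ≤ v ^ s * (A - B * (1 - v)) ^ s :=
    mul_nonneg (pow_nonneg hv.1 _) (pow_nonneg (h4.trans h3) _)
  exact mul_le_mul
    (mul_le_mul_of_nonneg_left (pow_le_pow_left₀ h4 h3 s) (pow_nonneg hv.1 _))
    (sub_le_sub (pow_le_pow_left₀ h4 h3 k) (pow_le_pow_left₀ h1 h0 k)) (sub_nonneg.mpr h5) h6

/-- Monotonicity in `A` of `betaDiff s k A B / A^(s+1)`, cross-multiplied. With `c = B (1 - v)`, the
quotient `(A - c) / A` is nondecreasing; it absorbs `A^s` in the middle factor, and the remaining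
`A` divides the bracket, where `(A - c)^l (A - c) / A` increases and `(B v)^(l+1) / A` decreases. -/
theorem betaDiff_mul_pow_le (s : ℕ) {k : ℕ} (hk : k ≠ 0) {A A' B : ℝ} (hB : 0 ≤ B) (hBA : B ≤ A)
    (hAA : A ≤ A') : betaDiff s k A B * A' ^ (s + 1) ≤ betaDiff s k A' B * A ^ (s + 1) := by
  rw [betaDiff, betaDiff, ← intervalIntegral.integral_mul_const,
    ← intervalIntegral.integral_mul_const]
  refine intervalIntegral.integral_mono_on zero_le_one
    (Continuous.intervalIntegrable (by fun_prop) _ _)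
    (Continuous.intervalIntegrable (by fun_prop) _ _) fun v hv => ?_
  obtain ⟨l, rfl⟩ := Nat.exists_eq_succ_of_ne_zero hk
  set c := B * (1 - v) with hc
  have hA : 0 ≤ A := hB.trans hBA
  have hc0 : 0 ≤ c := mul_nonneg hB (sub_nonneg.mpr hv.2)
  have h1 : 0 ≤ B * v := mul_nonneg hB hv.1
  have h2 : B * v ≤ A - c := by linarith
  have h3 : 0 ≤ A - c := h1.trans h2
  have h4 : (A - c) * A' ≤ (A' - c) * A := by nlinarith
  have h5 : ((A - c) * A') ^ s ≤ ((A' - c) * A) ^ s :=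
    pow_le_pow_left₀ (mul_nonneg h3 (hA.trans hAA)) h4 s
  have h6 : ((A - c) ^ (l + 1) - (B * v) ^ (l + 1)) * A' ≤
      ((A' - c) ^ (l + 1) - (B * v) ^ (l + 1)) * A := by
    have h7 : (A - c) ^ l * ((A - c) * A') ≤ (A' - c) ^ l * ((A' - c) * A) :=
      mul_le_mul (pow_le_pow_left₀ h3 (by linarith) l) h4 (mul_nonneg h3 (hA.trans hAA))
        (pow_nonneg (by linarith) _)
    have h8 := mul_le_mul_of_nonneg_left hAA (pow_nonneg h1 (l + 1))
    rw [pow_succ (A - c), pow_succ (A' - c)]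
    linarith
  have h9 : 0 ≤ ((A - c) ^ (l + 1) - (B * v) ^ (l + 1)) * A' :=
    mul_nonneg (sub_nonneg.mpr (pow_le_pow_left₀ h1 h2 _)) (hA.trans hAA)
  have h10 := mul_le_mul_of_nonneg_left
    (mul_le_mul h5 h6 h9 (pow_nonneg (mul_nonneg (by linarith) hA) _)) (pow_nonneg hv.1 s)
  rw [mul_pow (A - c), mul_pow (A' - c)] at h10
  simp only [Nat.succ_eq_add_one]
  calc _ = _ := by ring
    _ ≤ _ := h10
    _ = _ := by ring

/-! ### The kernel: sign and monotonicity. -/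

/-- The kernel representing the difference of the moduli of the errors of the two Hermite
interpolants, normalized so as to be monotone in `x`. -/
noncomputable def hermiteKernel (s k : ℕ) (a b x t : ℝ) : ℝ :=
  if t ≤ x then
    (t - a) ^ (s + 1) * betaDiff s k ((x - a) / (b - x) * (b - t)) (t - a) /
      ((x - a) / (b - x)) ^ (s + 1)
  else -((b - t) ^ (s + 1) * betaDiff s k (t - a) ((x - a) / (b - x) * (b - t)))

section hermiteKernel

variable {s k : ℕ} {a b x x' t : ℝ}

/-- From `(x - a)(b - t) - (t - a)(b - x) = (b - a)(x - t)`. This and its variants tell which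
argument of `betaDiff` is the larger one on each side of `x`. -/
theorem le_ratio_mul_iff (hx : x < b) (hab : a < b) :
    t - a ≤ (x - a) / (b - x) * (b - t) ↔ t ≤ x := by
  rw [div_mul_eq_mul_div, le_div_iff₀ (by linarith)]
  constructor
  · intro h; nlinarith
  · intro h; nlinarith

theorem ratio_mul_lt_iff (hx : x < b) (hab : a < b) :
    (x - a) / (b - x) * (b - t) < t - a ↔ x < t := by
  rw [← not_le, le_ratio_mul_iff hx hab, not_le]

theorem ratio_mul_le_iff (hx : x < b) (hab : a < b) :
    (x - a) / (b - x) * (b - t) ≤ t - a ↔ x ≤ t := by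
  rw [div_mul_eq_mul_div, div_le_iff₀ (by linarith)]
  constructor
  · intro h; nlinarith
  · intro h; nlinarith

theorem lt_ratio_mul_iff (hx : x < b) (hab : a < b) :
    t - a < (x - a) / (b - x) * (b - t) ↔ t < x := by
  rw [← not_le, ratio_mul_le_iff hx hab, not_le]

theorem ratio_pos (hx : x ∈ Set.Ioo a b) : 0 < (x - a) / (b - x) :=
  div_pos (sub_pos.mpr hx.1) (sub_pos.mpr hx.2)

theorem ratio_le_ratio (hx' : x' ∈ Set.Ioo a b) (h : x ≤ x') :
    (x - a) / (b - x) ≤ (x' - a) / (b - x') :=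
  div_le_div₀ (sub_nonneg.mpr hx'.1.le) (by linarith) (sub_pos.mpr hx'.2) (by linarith)

theorem continuous_hermiteKernel (hx : x < b) : Continuous (hermiteKernel s k a b x) := by
  have hJ := continuous_betaDiff s k
  refine Continuous.if_le ?_ ?_ continuous_id continuous_const ?_
  · refine Continuous.div_const (Continuous.mul (by fun_prop) ?_) _
    exact hJ.comp (f := fun t => ((x - a) / (b - x) * (b - t), t - a)) (by fun_prop)
  · refine (Continuous.mul (by fun_prop) ?_).neg
    exact hJ.comp (f := fun t => (t - a, (x - a) / (b - x) * (b - t))) (by fun_prop)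
  · rintro t (rfl : t = x)
    rw [div_mul_cancel₀ _ (by linarith), betaDiff_self]
    simp

theorem hermiteKernel_pos (hk : k ≠ 0) (hx : x ∈ Set.Ioo a b) (hat : a < t) (htx : t < x) :
    0 < hermiteKernel s k a b x t := by
  have hab := hx.1.trans hx.2
  rw [hermiteKernel, if_pos htx.le]
  exact div_pos (mul_pos (pow_pos (sub_pos.mpr hat) _)
    (betaDiff_pos s hk (sub_pos.mpr hat).le ((lt_ratio_mul_iff hx.2 hab).mpr htx)))
    (pow_pos (ratio_pos hx) _)

theorem hermiteKernel_nonneg (hk : k ≠ 0) (hx : x ∈ Set.Ioo a b) (hat : a ≤ t) (htx : t ≤ x) :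
    0 ≤ hermiteKernel s k a b x t := by
  rcases hat.eq_or_lt with rfl | hat
  · simp [hermiteKernel, hx.1.le]
  rcases htx.eq_or_lt with rfl | htx
  · simp [hermiteKernel, div_mul_cancel₀ _ (sub_pos.mpr hx.2).ne', betaDiff_self]
  · exact (hermiteKernel_pos hk hx hat htx).le

theorem hermiteKernel_neg (hk : k ≠ 0) (hx : x ∈ Set.Ioo a b) (hxt : x < t) (htb : t < b) :
    hermiteKernel s k a b x t < 0 := by
  have hab := hx.1.trans hx.2
  rw [hermiteKernel, if_neg hxt.not_ge, neg_lt_zero]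
  exact mul_pos (pow_pos (sub_pos.mpr htb) _) (betaDiff_pos s hk
    (mul_pos (ratio_pos hx) (sub_pos.mpr htb)).le ((ratio_mul_lt_iff hx.2 hab).mpr hxt))

theorem hermiteKernel_nonpos (hk : k ≠ 0) (hx : x ∈ Set.Ioo a b) (hxt : x ≤ t) (htb : t ≤ b) :
    hermiteKernel s k a b x t ≤ 0 := by
  rcases htb.eq_or_lt with rfl | htb
  · simp [hermiteKernel, hx.2.not_ge]
  rcases hxt.eq_or_lt with rfl | hxt
  · simp [hermiteKernel, div_mul_cancel₀ _ (sub_pos.mpr hx.2).ne', betaDiff_self]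
  · exact (hermiteKernel_neg hk hx hxt htb).le

/-- The kernel depends on `x` through `y = (x - a) / (b - x)`, which increases with `x`. Left of
both points `betaDiff_mul_pow_le` applies, right of both `betaDiff_le_betaDiff_of_le_right`; between
them the kernel passes from nonpositive to nonnegative. -/
theorem hermiteKernel_mono (hk : k ≠ 0) (hx : x ∈ Set.Ioo a b) (hx' : x' ∈ Set.Ioo a b)
    (hxx : x ≤ x') (ht : t ∈ Set.Icc a b) :
    hermiteKernel s k a b x t ≤ hermiteKernel s k a b x' t := by
  have hab := hx.1.trans hx.2
  have hy := ratio_pos hx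
  have hy' := ratio_pos hx'
  have hyy := ratio_le_ratio hx' hxx
  have hp : 0 ≤ b - t := sub_nonneg.mpr ht.2
  have hq : 0 ≤ t - a := sub_nonneg.mpr ht.1
  rcases le_or_gt t x with h1 | h1
  · have h2 := (le_ratio_mul_iff hx.2 hab).mpr h1
    rw [hermiteKernel, hermiteKernel, if_pos h1, if_pos (h1.trans hxx),
      div_le_div_iff₀ (pow_pos hy _) (pow_pos hy' _), mul_assoc, mul_assoc]
    refine mul_le_mul_of_nonneg_left ?_ (pow_nonneg hq _)
    have h3 := betaDiff_mul_pow_le s hk hq h2 (mul_le_mul_of_nonneg_right hyy hp)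
    have hp' : 0 < b - t := by linarith [hx.2]
    rw [mul_pow, mul_pow, ← mul_assoc, ← mul_assoc] at h3
    exact le_of_mul_le_mul_right h3 (pow_pos hp' _)
  · rcases le_or_gt t x' with h2 | h2
    · exact (hermiteKernel_nonpos hk hx h1.le ht.2).trans (hermiteKernel_nonneg hk hx' ht.1 h2)
    · rw [hermiteKernel, hermiteKernel, if_neg h1.not_ge, if_neg h2.not_ge, neg_le_neg_iff]
      exact mul_le_mul_of_nonneg_left (betaDiff_le_betaDiff_of_le_right s k
        (mul_nonneg hy.le hp) (mul_le_mul_of_nonneg_right hyy hp)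
        ((ratio_mul_le_iff hx'.2 hab).mpr h2.le)) (pow_nonneg hp _)

end hermiteKernel

/-! ### Integrals of the kernel against a positive weight. -/

section hermiteKernel

variable {s k : ℕ} {a b : ℝ} {w : ℝ → ℝ}

theorem continuousOn_hermiteKernel_mul {x : ℝ} (hx : x ∈ Set.Ioo a b)
    (hw : ContinuousOn w (Set.Icc a b)) :
    ContinuousOn (fun t => hermiteKernel s k a b x t * w t) (Set.Icc a b) :=
  (continuous_hermiteKernel hx.2).continuousOn.mul hw

theorem intervalIntegrable_hermiteKernel_mul {x c d : ℝ} (hx : x ∈ Set.Ioo a b)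
    (hw : ContinuousOn w (Set.Icc a b)) (hc : c ∈ Set.Icc a b) (hd : d ∈ Set.Icc a b) :
    IntervalIntegrable (fun t => hermiteKernel s k a b x t * w t) MeasureTheory.volume c d :=
  ((continuousOn_hermiteKernel_mul hx hw).mono
    (Set.ordConnected_Icc.uIcc_subset hc hd)).intervalIntegrable

theorem strictMonoOn_integral_hermiteKernel (hk : k ≠ 0)
    (hw : ContinuousOn w (Set.Icc a b)) (hpos : ∀ t ∈ Set.Icc a b, 0 < w t) :
    StrictMonoOn (fun x => ∫ t in a..b, hermiteKernel s k a b x t * w t) (Set.Ioo a b) := by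
  intro x hx x' hx' hxx
  have hab := hx.1.trans hx.2
  have ha : a ∈ Set.Icc a b := ⟨le_rfl, hab.le⟩
  have hb : b ∈ Set.Icc a b := ⟨hab.le, le_rfl⟩
  rw [← sub_pos, ← intervalIntegral.integral_sub
    (intervalIntegrable_hermiteKernel_mul hx' hw ha hb)
    (intervalIntegrable_hermiteKernel_mul hx hw ha hb)]
  -- At the midpoint the kernel is negative for `x` and positive for `x'`, which makes the
  -- comparison strict.
  have hm1 : x < (x + x') / 2 := by linarith
  have hm2 : (x + x') / 2 < x' := by linarith
  have hm : (x + x') / 2 ∈ Set.Icc a b := ⟨(hx.1.trans hm1).le, (hm2.trans hx'.2).le⟩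
  refine intervalIntegral.integral_pos hab
    ((continuousOn_hermiteKernel_mul hx' hw).sub (continuousOn_hermiteKernel_mul hx hw))
    (fun t ht => ?_) ⟨_, hm, ?_⟩
  · have ht := Set.Ioc_subset_Icc_self ht
    exact sub_nonneg.mpr (mul_le_mul_of_nonneg_right (hermiteKernel_mono hk hx hx' hxx.le ht)
      (hpos t ht).le)
  · exact sub_pos.mpr (mul_lt_mul_of_pos_right
      ((hermiteKernel_neg hk hx hm1 (hm2.trans hx'.2)).trans
        (hermiteKernel_pos hk hx' (hx.1.trans hm1) hm2)) (hpos _ hm))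

/-- Comparison with the fixed midpoint `c` avoids any limit of the kernel. For `x < c`, the kernel
at `x` is at most the one at `c` on `[a,x]` and `[c,b]`, and nonpositive on `[x,c]`. The integral of
the kernel at `c` over `[a,x]` tends to zero as `x` tends to `a`, while that over `[c,b]` is a fixed
negative number. The positive case is the mirror image. -/
theorem exists_integral_hermiteKernel_neg (hk : k ≠ 0) (hab : a < b)
    (hw : ContinuousOn w (Set.Icc a b)) (hpos : ∀ t ∈ Set.Icc a b, 0 < w t) :
    ∃ x ∈ Set.Ioo a b, ∫ t in a..b, hermiteKernel s k a b x t * w t < 0 := by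
  set c := (a + b) / 2 with hc
  have hcm : c ∈ Set.Ioo a b := ⟨by linarith, by linarith⟩
  have hcm' := Set.Ioo_subset_Icc_self hcm
  have ha : a ∈ Set.Icc a b := ⟨le_rfl, hab.le⟩
  have hb : b ∈ Set.Icc a b := ⟨hab.le, le_rfl⟩
  have hδ : 0 < ∫ t in c..b, -(hermiteKernel s k a b c t * w t) := by
    refine intervalIntegral.integral_pos hcm.2
      ((continuousOn_hermiteKernel_mul hcm hw).neg.mono (Set.Icc_subset_Icc_left hcm.1.le))
      (fun t ht => ?_) ⟨(c + b) / 2, ⟨by linarith [hcm.2], by linarith [hcm.2]⟩, ?_⟩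
    · rw [← neg_mul]
      exact mul_nonneg (neg_nonneg.mpr (hermiteKernel_nonpos hk hcm ht.1.le ht.2))
        (hpos t ⟨hcm.1.le.trans ht.1.le, ht.2⟩).le
    · rw [← neg_mul]
      exact mul_pos (neg_pos.mpr (hermiteKernel_neg hk hcm (by linarith [hcm.2])
        (by linarith [hcm.2]))) (hpos _ ⟨by linarith [hcm.2], by linarith [hcm.2]⟩)
  rw [intervalIntegral.integral_neg] at hδ
  have hG : ContinuousOn (fun x => ∫ t in a..x, hermiteKernel s k a b c t * w t)
      (Set.uIcc a b) := by
    refine intervalIntegral.continuousOn_primitive_interval ?_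
    rw [Set.uIcc_of_le hab.le]
    exact (continuousOn_hermiteKernel_mul hcm hw).integrableOn_Icc
  have hG0 := (hG a Set.left_mem_uIcc).mono_left
    (nhdsWithin_mono a (Set.Icc_subset_uIcc.trans' Set.Ioo_subset_Icc_self))
  rw [nhdsWithin_Ioo_eq_nhdsGT hab] at hG0
  simp only [intervalIntegral.integral_same] at hG0
  obtain ⟨x, hx1, hx2⟩ := ((hG0.eventually (gt_mem_nhds hδ)).and
    (Ioo_mem_nhdsGT hcm.1)).exists
  have hx : x ∈ Set.Ioo a b := ⟨hx2.1, hx2.2.trans hcm.2⟩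
  have hx' := Set.Ioo_subset_Icc_self hx
  refine ⟨x, hx, ?_⟩
  rw [← intervalIntegral.integral_add_adjacent_intervals
      (intervalIntegrable_hermiteKernel_mul hx hw ha hx')
      (intervalIntegrable_hermiteKernel_mul hx hw hx' hb),
    ← intervalIntegral.integral_add_adjacent_intervals
      (intervalIntegrable_hermiteKernel_mul hx hw hx' hcm')
      (intervalIntegrable_hermiteKernel_mul hx hw hcm' hb)]
  have hmono : ∀ t ∈ Set.Icc a b,
      hermiteKernel s k a b x t * w t ≤ hermiteKernel s k a b c t * w t := fun t ht =>
    mul_le_mul_of_nonneg_right (hermiteKernel_mono hk hx hcm hx2.2.le ht) (hpos t ht).le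
  have i1 := intervalIntegral.integral_mono_on hx.1.le
    (intervalIntegrable_hermiteKernel_mul (s := s) (k := k) hx hw ha hx')
    (intervalIntegrable_hermiteKernel_mul hcm hw ha hx')
    (fun t ht => hmono t ⟨ht.1, ht.2.trans hx.2.le⟩)
  have i2 : 0 ≤ ∫ t in x..c, -(hermiteKernel s k a b x t * w t) :=
    intervalIntegral.integral_nonneg hx2.2.le fun t ht => by
      rw [← neg_mul]
      exact mul_nonneg (neg_nonneg.mpr
        (hermiteKernel_nonpos hk hx ht.1 (ht.2.trans hcm.2.le)))
        (hpos t ⟨hx.1.le.trans ht.1, ht.2.trans hcm.2.le⟩).le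
  rw [intervalIntegral.integral_neg] at i2
  have i3 := intervalIntegral.integral_mono_on hcm.2.le
    (intervalIntegrable_hermiteKernel_mul (s := s) (k := k) hx hw hcm' hb)
    (intervalIntegrable_hermiteKernel_mul hcm hw hcm' hb)
    (fun t ht => hmono t ⟨hcm.1.le.trans ht.1, ht.2⟩)
  linarith

theorem exists_integral_hermiteKernel_pos (hk : k ≠ 0) (hab : a < b)
    (hw : ContinuousOn w (Set.Icc a b)) (hpos : ∀ t ∈ Set.Icc a b, 0 < w t) :
    ∃ x ∈ Set.Ioo a b, 0 < ∫ t in a..b, hermiteKernel s k a b x t * w t := by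
  set c := (a + b) / 2 with hc
  have hcm : c ∈ Set.Ioo a b := ⟨by linarith, by linarith⟩
  have hcm' := Set.Ioo_subset_Icc_self hcm
  have ha : a ∈ Set.Icc a b := ⟨le_rfl, hab.le⟩
  have hb : b ∈ Set.Icc a b := ⟨hab.le, le_rfl⟩
  have hδ : 0 < ∫ t in a..c, hermiteKernel s k a b c t * w t := by
    refine intervalIntegral.integral_pos hcm.1
      ((continuousOn_hermiteKernel_mul hcm hw).mono (Set.Icc_subset_Icc_right hcm.2.le))
      (fun t ht => ?_) ⟨(a + c) / 2, ⟨by linarith [hcm.1], by linarith [hcm.1]⟩, ?_⟩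
    · exact mul_nonneg (hermiteKernel_nonneg hk hcm ht.1.le ht.2)
        (hpos t ⟨ht.1.le, ht.2.trans hcm.2.le⟩).le
    · exact mul_pos (hermiteKernel_pos hk hcm (by linarith [hcm.1])
        (by linarith [hcm.1])) (hpos _ ⟨by linarith [hcm.1], by linarith [hcm.1]⟩)
  have hG : ContinuousOn (fun x => ∫ t in x..b, hermiteKernel s k a b c t * w t)
      (Set.uIcc a b) := by
    refine intervalIntegral.continuousOn_primitive_interval_left ?_
    rw [Set.uIcc_of_le hab.le]
    exact (continuousOn_hermiteKernel_mul hcm hw).integrableOn_Icc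
  have hG0 := (hG b Set.right_mem_uIcc).mono_left
    (nhdsWithin_mono b (Set.Icc_subset_uIcc.trans' Set.Ioo_subset_Icc_self))
  rw [nhdsWithin_Ioo_eq_nhdsLT hab] at hG0
  simp only [intervalIntegral.integral_same] at hG0
  obtain ⟨x, hx1, hx2⟩ := ((hG0.eventually (lt_mem_nhds (neg_lt_zero.mpr hδ))).and
    (Ioo_mem_nhdsLT hcm.2)).exists
  have hx : x ∈ Set.Ioo a b := ⟨hcm.1.trans hx2.1, hx2.2⟩
  have hx' := Set.Ioo_subset_Icc_self hx
  refine ⟨x, hx, ?_⟩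
  rw [← intervalIntegral.integral_add_adjacent_intervals
      (intervalIntegrable_hermiteKernel_mul hx hw ha hcm')
      (intervalIntegrable_hermiteKernel_mul hx hw hcm' hb),
    ← intervalIntegral.integral_add_adjacent_intervals
      (intervalIntegrable_hermiteKernel_mul hx hw hcm' hx')
      (intervalIntegrable_hermiteKernel_mul hx hw hx' hb)]
  have hmono : ∀ t ∈ Set.Icc a b,
      hermiteKernel s k a b c t * w t ≤ hermiteKernel s k a b x t * w t := fun t ht =>
    mul_le_mul_of_nonneg_right (hermiteKernel_mono hk hcm hx hx2.1.le ht) (hpos t ht).le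
  have i1 := intervalIntegral.integral_mono_on hcm.1.le
    (intervalIntegrable_hermiteKernel_mul (s := s) (k := k) hcm hw ha hcm')
    (intervalIntegrable_hermiteKernel_mul hx hw ha hcm')
    (fun t ht => hmono t ⟨ht.1, ht.2.trans hcm.2.le⟩)
  have i2 : 0 ≤ ∫ t in c..x, hermiteKernel s k a b x t * w t :=
    intervalIntegral.integral_nonneg hx2.1.le fun t ht =>
      mul_nonneg (hermiteKernel_nonneg hk hx (hcm.1.le.trans ht.1) ht.2)
        (hpos t ⟨hcm.1.le.trans ht.1, ht.2.trans hx.2.le⟩).le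
  have i3 := intervalIntegral.integral_mono_on hx.2.le
    (intervalIntegrable_hermiteKernel_mul (s := s) (k := k) hcm hw hx' hb)
    (intervalIntegrable_hermiteKernel_mul hx hw hx' hb)
    (fun t ht => hmono t ⟨hx.1.le.trans ht.1, ht.2⟩)
  linarith

/-- Since the integral against `w` vanishes, `φ` may be replaced by `φ - φ x`, whose sign is
opposite to that of the kernel on both sides of `x`. -/
theorem integral_hermiteKernel_mul_neg (hk : k ≠ 0) {x : ℝ} (hx : x ∈ Set.Ioo a b)
    (hw : ContinuousOn w (Set.Icc a b)) (hpos : ∀ t ∈ Set.Icc a b, 0 < w t) {φ : ℝ → ℝ}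
    (hφc : ContinuousOn φ (Set.Icc a b)) (hφ : StrictMonoOn φ (Set.Icc a b))
    (h0 : ∫ t in a..b, hermiteKernel s k a b x t * w t = 0) :
    ∫ t in a..b, hermiteKernel s k a b x t * (w t * φ t) < 0 := by
  have hab := hx.1.trans hx.2
  have ha : a ∈ Set.Icc a b := ⟨le_rfl, hab.le⟩
  have hb : b ∈ Set.Icc a b := ⟨hab.le, le_rfl⟩
  have hx' := Set.Ioo_subset_Icc_self hx
  have hpos' : 0 < ∫ t in a..b, (φ x * (hermiteKernel s k a b x t * w t) -
      hermiteKernel s k a b x t * (w t * φ t)) := by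
    have hm1 : a < (a + x) / 2 := by linarith [hx.1]
    have hm2 : (a + x) / 2 < x := by linarith [hx.1]
    have hm : (a + x) / 2 ∈ Set.Icc a b := ⟨hm1.le, (hm2.trans hx.2).le⟩
    have heq : ∀ t, φ x * (hermiteKernel s k a b x t * w t) -
        hermiteKernel s k a b x t * (w t * φ t) =
        hermiteKernel s k a b x t * (φ x - φ t) * w t := fun t => by ring
    refine intervalIntegral.integral_pos hab
      ((continuousOn_const.mul (continuousOn_hermiteKernel_mul hx hw)).sub
        (continuousOn_hermiteKernel_mul hx (hw.mul hφc)))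
      (fun t ht => ?_) ⟨_, hm, ?_⟩
    · have ht := Set.Ioc_subset_Icc_self ht
      rw [heq]
      refine mul_nonneg ?_ (hpos t ht).le
      rcases le_total t x with h | h
      · exact mul_nonneg (hermiteKernel_nonneg hk hx ht.1 h)
          (sub_nonneg.mpr (hφ.monotoneOn ht hx' h))
      · exact mul_nonneg_of_nonpos_of_nonpos (hermiteKernel_nonpos hk hx h ht.2)
          (sub_nonpos.mpr (hφ.monotoneOn hx' ht h))
    · rw [heq]
      exact mul_pos (mul_pos (hermiteKernel_pos hk hx hm1 hm2) (sub_pos.mpr (hφ hm hx' hm2)))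
        (hpos _ hm)
  rw [intervalIntegral.integral_sub
    ((intervalIntegrable_hermiteKernel_mul hx hw ha hb).const_mul _)
    (intervalIntegrable_hermiteKernel_mul (w := fun t => w t * φ t) hx (hw.mul hφc) ha hb),
    intervalIntegral.integral_const_mul, h0, mul_zero, zero_sub] at hpos'
  exact neg_pos.mp hpos'

end hermiteKernel

/-! ### Derivatives of the power generators. -/

theorem hasDerivAt_iteratedDeriv {f : ℝ → ℝ} {t : ℝ} (hf : AnalyticAt ℝ f t) (j : ℕ) :
    HasDerivAt (iteratedDeriv j f) (iteratedDeriv (j + 1) f t) t := by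
  rw [iteratedDeriv_succ, iteratedDeriv_eq_iterate]
  exact (hf.iterated_deriv j).differentiableAt.hasDerivAt

theorem analyticAt_rpow_const (p : ℝ) {t : ℝ} (ht : 0 < t) :
    AnalyticAt ℝ (fun x : ℝ => x ^ p) t :=
  (Real.contDiffAt_rpow_const_of_ne (n := ⊤) ht.ne').analyticAt

theorem analyticAt_powerGenerator (n : ℕ) (p : ℝ) {t : ℝ} (ht : 0 < t) :
    AnalyticAt ℝ (powerGenerator n p) t := by
  unfold powerGenerator
  split_ifs
  · exact (analyticAt_rpow_const p ht).mul (analyticAt_log ht)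
  · exact analyticAt_rpow_const p ht

/-- Differentiating `x^(k+1) log x` once gives `(k+1) x^k log x + x^k`; the remaining derivatives
kill `x^k`, so the induction lowers `k` and `n` together. -/
theorem iteratedDeriv_pow_mul_log (k n : ℕ) (hkn : k ≤ n) :
    ∃ c : ℝ, c ≠ 0 ∧ ∀ x : ℝ, 0 < x →
      iteratedDeriv (n + 1) (fun x => x ^ k * Real.log x) x = c * x ^ ((k : ℝ) - (n + 1)) := by
  induction k generalizing n with
  | zero =>
    refine ⟨(-1) ^ n * n.factorial, by positivity, fun x _ => ?_⟩
    have : (fun x : ℝ => x ^ 0 * Real.log x) = Real.log := by simp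
    rw [this, iteratedDeriv_succ', Real.deriv_log', iteratedDeriv_eq_iterate, iter_deriv_inv, ← Real.rpow_intCast]
    congr 2
    push_cast
    ring
  | succ k ih =>
    obtain ⟨m, rfl⟩ : ∃ m, n = m + 1 := ⟨n - 1, by omega⟩
    obtain ⟨c, hc, h⟩ := ih m (by omega)
    refine ⟨(k + 1) * c, mul_ne_zero (by positivity) hc, fun x hx => ?_⟩
    have hd : deriv (fun x : ℝ => x ^ (k + 1) * Real.log x) =ᶠ[nhds x]
        fun x => ((k : ℝ) + 1) * (x ^ k * Real.log x) + x ^ k := by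
      filter_upwards [Ioi_mem_nhds hx] with y hy
      refine (((hasDerivAt_pow (k + 1) y).mul (Real.hasDerivAt_log (ne_of_gt hy))).congr_deriv
        ?_).deriv
      have : y ≠ 0 := ne_of_gt hy
      push_cast
      rw [pow_succ]
      field_simp
    have hA : AnalyticAt ℝ (fun x : ℝ => ((k : ℝ) + 1) * (x ^ k * Real.log x)) x :=
      analyticAt_const.mul ((analyticAt_id.pow k).mul (analyticAt_log hx))
    have hB : AnalyticAt ℝ (fun x : ℝ => x ^ k) x := analyticAt_id.pow k
    rw [iteratedDeriv_succ', hd.iteratedDeriv_eq, iteratedDeriv_fun_add hA.contDiffAt hB.contDiffAt,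
      iteratedDeriv_const_mul_field, h x hx, iteratedDeriv_eq_iterate, iter_deriv_pow',
      Finset.prod_eq_zero (Finset.mem_range.mpr (by omega : k < m + 1)) (sub_self _)]
    simp only [zero_mul, add_zero, mul_assoc]
    congr 3
    push_cast
    ring

/-- This explains the logarithms: `p (p - 1) ⋯ (p - n)` vanishes exactly for `p` in `{0, ..., n}`,
and there the factor `log x` restores a nonzero constant. -/
theorem exists_iteratedDeriv_powerGenerator (n : ℕ) (p : ℝ) :
    ∃ c : ℝ, c ≠ 0 ∧ ∀ x : ℝ, 0 < x →
      iteratedDeriv (n + 1) (powerGenerator n p) x = c * x ^ (p - (n + 1)) := by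
  by_cases hp : ∃ k : ℕ, k ≤ n ∧ p = k
  · obtain ⟨c, hc, h⟩ := iteratedDeriv_pow_mul_log hp.choose n hp.choose_spec.1
    refine ⟨c, hc, fun x hx => ?_⟩
    have hf : powerGenerator n p = fun x => x ^ hp.choose * Real.log x := by
      funext y
      rw [powerGenerator, if_pos hp, ← Real.rpow_natCast, ← hp.choose_spec.2]
    rw [hf, h x hx, ← hp.choose_spec.2]
  · have hf : powerGenerator n p = fun x => x ^ p := by
      funext y
      rw [powerGenerator, if_neg hp]
    refine ⟨(descPochhammer ℝ (n + 1)).eval p, ?_, fun x _ => ?_⟩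
    · rw [descPochhammer_eval_eq_prod_range]
      refine Finset.prod_ne_zero_iff.mpr fun j hj h => hp ⟨j, ?_, sub_eq_zero.mp h⟩
      exact Nat.lt_succ_iff.mp (Finset.mem_range.mp hj)
    · rw [hf, iteratedDeriv_eq_iterate, Real.iter_deriv_rpow_const]
      push_cast
      rfl

/-! ### From interpolation errors to the kernel. -/

/-- The factor `(-1)^(s+1)` cancels the signs of the beta formulas on both intervals, since `-(-1)^n
(-1)^(r+1) = (-1)^(s+1)`. Keeping `n` separate lets `P` and `Q`, whose orders are swapped, share one
expression for it. -/
theorem IsHermiteInterpolant.error_eq_betaKernel {f : ℝ → ℝ} {a b x : ℝ} {n r s : ℕ} {P : ℝ[X]}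
    (hP : IsHermiteInterpolant f a b r s P) (hn : n = r + s + 1) (hx : x ∈ Set.Icc a b)
    (hf : ∀ t ∈ Set.Icc a b, AnalyticAt ℝ f t) :
    r.factorial * s.factorial * (b - a) ^ n * ((-1) ^ (s + 1) * (f x - P.eval x)) =
      (∫ t in a..x, iteratedDeriv (n + 1) f t *
        betaKernel r s ((x - a) * (b - t)) ((t - a) * (b - x))) +
      ∫ t in x..b, iteratedDeriv (n + 1) f t *
        betaKernel s r ((t - a) * (b - x)) ((x - a) * (b - t)) := by
  subst hn
  have h := hP.error_eq hx (fun j _ t ht => hasDerivAt_iteratedDeriv (hf t ht) j)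
    (fun t ht => (hasDerivAt_iteratedDeriv (hf t ht) _).continuousAt.continuousWithinAt)
  set n := r + s + 1 with hn
  have hsq : ∀ m : ℕ, ((-1 : ℝ) ^ m) * (-1) ^ m = 1 := fun m => by rw [← mul_pow]; simp
  have e1 : (n.factorial : ℝ) * (∫ t in a..x, iteratedDeriv (n + 1) f t *
        betaKernel r s ((x - a) * (b - t)) ((t - a) * (b - x))) =
      ((-1) ^ (s + 1) * r.factorial * s.factorial) * ∫ t in a..x, iteratedDeriv (n + 1) f t *
        truncatedBinomial n r ((x - a) * (b - t)) ((t - a) * (b - x)) := by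
    rw [← intervalIntegral.integral_const_mul, ← intervalIntegral.integral_const_mul]
    refine intervalIntegral.integral_congr fun t _ => ?_
    have := truncatedBinomial_eq_integral r s ((x - a) * (b - t)) ((t - a) * (b - x))
    rw [← betaKernel, ← hn] at this
    linear_combination (-(-1) ^ (s + 1) * iteratedDeriv (n + 1) f t) * this -
      (n.factorial * iteratedDeriv (n + 1) f t *
        betaKernel r s ((x - a) * (b - t)) ((t - a) * (b - x))) * hsq (s + 1)
  have e2 : (n.factorial : ℝ) * (∫ t in x..b, iteratedDeriv (n + 1) f t *
        betaKernel s r ((t - a) * (b - x)) ((x - a) * (b - t))) =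
      -((-1) ^ (s + 1) * r.factorial * s.factorial) * ∫ t in x..b, iteratedDeriv (n + 1) f t *
        ((-1) ^ n * truncatedBinomial n s ((t - a) * (b - x)) ((x - a) * (b - t))) := by
    rw [← intervalIntegral.integral_const_mul, ← intervalIntegral.integral_const_mul]
    refine intervalIntegral.integral_congr fun t _ => ?_
    have := truncatedBinomial_eq_integral s r ((t - a) * (b - x)) ((x - a) * (b - t))
    rw [← betaKernel, add_comm s r, ← hn] at this
    have hs : -((-1 : ℝ) ^ (s + 1)) * (-1) ^ n = (-1) ^ (r + 1) := by
      rw [hn]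
      linear_combination ((-1) ^ (r + 1)) * hsq s
    linear_combination (-(-1) ^ (r + 1) * iteratedDeriv (n + 1) f t) * this -
      (n.factorial * iteratedDeriv (n + 1) f t *
        betaKernel s r ((t - a) * (b - x)) ((x - a) * (b - t))) * hsq (r + 1) -
      (r.factorial * s.factorial * iteratedDeriv (n + 1) f t *
        truncatedBinomial n s ((t - a) * (b - x)) ((x - a) * (b - t))) * hs
  have hfac : (n.factorial : ℝ) ≠ 0 := by exact_mod_cast n.factorial_ne_zero
  refine mul_left_cancel₀ hfac ?_
  rw [mul_add, e1, e2]
  linear_combination ((-1) ^ (s + 1) * r.factorial * s.factorial) * h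

/-- Homogeneity extracts `b - x` from both arguments, leaving the ratio `y = (x - a) / (b - x)`. For
`t ≤ x` the factor `y^(s+1)` undoes the normalization of the kernel; for `t > x` it comes from the
second argument. The prefactor is therefore the same on both sides of `x`. -/
theorem betaKernel_sub_eq_hermiteKernel {s k : ℕ} {a b x t : ℝ} (hx : x ∈ Set.Ioo a b)
    (ht : t ≤ x) :
    betaKernel (s + k) s ((x - a) * (b - t)) ((t - a) * (b - x)) -
      betaKernel s (s + k) ((x - a) * (b - t)) ((t - a) * (b - x)) =
    (b - x) ^ (s + k + s + 1) * ((x - a) / (b - x)) ^ (s + 1) * hermiteKernel s k a b x t := by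
  have hy := ratio_pos hx
  rw [betaKernel_sub_betaKernel, hermiteKernel, if_pos ht,
    show (x - a) * (b - t) = (b - x) * ((x - a) / (b - x) * (b - t)) by
      field_simp [(sub_pos.mpr hx.2).ne'],
    mul_comm (t - a), betaDiff_smul, mul_assoc, mul_div_cancel₀ _ (pow_pos hy _).ne', mul_pow]
  ring

theorem betaKernel_sub_eq_neg_hermiteKernel {s k : ℕ} {a b x t : ℝ} (hx : x ∈ Set.Ioo a b)
    (ht : x < t) :
    betaKernel s (s + k) ((t - a) * (b - x)) ((x - a) * (b - t)) -
      betaKernel (s + k) s ((t - a) * (b - x)) ((x - a) * (b - t)) =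
    (b - x) ^ (s + k + s + 1) * ((x - a) / (b - x)) ^ (s + 1) * hermiteKernel s k a b x t := by
  rw [← neg_sub, betaKernel_sub_betaKernel, hermiteKernel, if_neg ht.not_ge,
    show (x - a) * (b - t) = (b - x) * ((x - a) / (b - x) * (b - t)) by
      field_simp [(sub_pos.mpr hx.2).ne'],
    mul_comm (t - a), betaDiff_smul, mul_pow, mul_pow]
  ring

/-- The sign normalizing the error of `Q` is `(-1)^(s+k+1)`, against `(-1)^(s+1)` for `P`; this is
the origin of `(-1)^k`. -/
theorem hermite_error_sub_error_eq {f w : ℝ → ℝ} {a b c x : ℝ} {s k : ℕ} {P Q : ℝ[X]}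
    (hf : ∀ t ∈ Set.Icc a b, AnalyticAt ℝ f t)
    (hfw : ∀ t ∈ Set.Icc a b, iteratedDeriv (s + k + s + 1 + 1) f t = c * w t)
    (hw : ContinuousOn w (Set.Icc a b))
    (hP : IsHermiteInterpolant f a b (s + k) s P) (hQ : IsHermiteInterpolant f a b s (s + k) Q)
    (hx : x ∈ Set.Ioo a b) :
    (s + k).factorial * s.factorial * (b - a) ^ (s + k + s + 1) *
      ((-1) ^ (s + 1) * ((f x - P.eval x) - (-1) ^ k * (f x - Q.eval x))) =
    (b - x) ^ (s + k + s + 1) * ((x - a) / (b - x)) ^ (s + 1) * c *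
      ∫ t in a..b, hermiteKernel s k a b x t * w t := by
  have hx' := Set.Ioo_subset_Icc_self hx
  have hab := hx.1.trans hx.2
  have ha : a ∈ Set.Icc a b := ⟨le_rfl, hab.le⟩
  have hb : b ∈ Set.Icc a b := ⟨hab.le, le_rfl⟩
  have eP := hP.error_eq_betaKernel rfl hx' hf
  have eQ := hQ.error_eq_betaKernel (n := s + k + s + 1) (by ring) hx' hf
  set n := s + k + s + 1 with hn
  set g := iteratedDeriv (n + 1) f with hg
  have hgc : ContinuousOn g (Set.Icc a b) := fun t ht =>
    (hasDerivAt_iteratedDeriv (hf t ht) _).continuousAt.continuousWithinAt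
  have hint : ∀ (r m : ℕ) (A B : ℝ → ℝ), Continuous A → Continuous B → ∀ d ∈ Set.Icc a b,
      ∀ e ∈ Set.Icc a b, IntervalIntegrable (fun t => g t * betaKernel r m (A t) (B t))
        MeasureTheory.volume d e := by
    intro r m A B hA hB d hd e he
    refine ContinuousOn.intervalIntegrable (ContinuousOn.mul
      (hgc.mono (Set.ordConnected_Icc.uIcc_subset hd he)) (Continuous.continuousOn ?_))
    exact (continuous_betaKernel r m).comp (f := fun t => (A t, B t)) (by fun_prop)
  set M := (b - x) ^ n * ((x - a) / (b - x)) ^ (s + 1) with hM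
  have i1 : (∫ t in a..x, g t * betaKernel (s + k) s ((x - a) * (b - t)) ((t - a) * (b - x))) -
      (∫ t in a..x, g t * betaKernel s (s + k) ((x - a) * (b - t)) ((t - a) * (b - x))) =
      M * c * ∫ t in a..x, hermiteKernel s k a b x t * w t := by
    rw [← intervalIntegral.integral_const_mul, ← intervalIntegral.integral_sub
      (hint _ _ _ _ (by fun_prop) (by fun_prop) _ ha _ hx')
      (hint _ _ _ _ (by fun_prop) (by fun_prop) _ ha _ hx')]
    refine intervalIntegral.integral_congr_ae (Filter.Eventually.of_forall fun t ht => ?_)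
    rw [Set.uIoc_of_le hx.1.le] at ht
    rw [← mul_sub, betaKernel_sub_eq_hermiteKernel hx ht.2, hfw t ⟨ht.1.le, ht.2.trans hx.2.le⟩]
    ring
  have i2 : (∫ t in x..b, g t * betaKernel s (s + k) ((t - a) * (b - x)) ((x - a) * (b - t))) -
      (∫ t in x..b, g t * betaKernel (s + k) s ((t - a) * (b - x)) ((x - a) * (b - t))) =
      M * c * ∫ t in x..b, hermiteKernel s k a b x t * w t := by
    rw [← intervalIntegral.integral_const_mul, ← intervalIntegral.integral_sub
      (hint _ _ _ _ (by fun_prop) (by fun_prop) _ hx' _ hb)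
      (hint _ _ _ _ (by fun_prop) (by fun_prop) _ hx' _ hb)]
    refine intervalIntegral.integral_congr_ae (Filter.Eventually.of_forall fun t ht => ?_)
    rw [Set.uIoc_of_le hx.2.le] at ht
    rw [← mul_sub, betaKernel_sub_eq_neg_hermiteKernel hx ht.1,
      hfw t ⟨hx.1.le.trans ht.1.le, ht.2⟩]
    ring
  rw [← intervalIntegral.integral_add_adjacent_intervals
    (intervalIntegrable_hermiteKernel_mul hx hw ha hx')
    (intervalIntegrable_hermiteKernel_mul hx hw hx' hb), mul_add, ← i1, ← i2]
  linear_combination eP - eQ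

/-- For even `k` the combination of errors is `Q x - P x`, for odd `k` it is `2 f x - P x - Q x`.
The criterion does not depend on the choice of `P` and `Q`, so their existence suffices for the
converse. -/
theorem isHermiteMeanPoint_iff {f w : ℝ → ℝ} {a b c x : ℝ} {s k : ℕ} (hab : a < b) (hc : c ≠ 0)
    (hf : ∀ t ∈ Set.Icc a b, AnalyticAt ℝ f t)
    (hfw : ∀ t ∈ Set.Icc a b, iteratedDeriv (s + k + s + 1 + 1) f t = c * w t)
    (hw : ContinuousOn w (Set.Icc a b)) :
    IsHermiteMeanPoint f (s + k) s a b x ↔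
      x ∈ Set.Ioo a b ∧ ∫ t in a..b, hermiteKernel s k a b x t * w t = 0 := by
  rw [IsHermiteMeanPoint, min_eq_left hab.le, max_eq_right hab.le, Nat.add_sub_cancel_left]
  refine and_congr_right fun hx => ?_
  have hM : (b - x) ^ (s + k + s + 1) * ((x - a) / (b - x)) ^ (s + 1) * c ≠ 0 :=
    mul_ne_zero (mul_ne_zero (pow_pos (sub_pos.mpr hx.2) _).ne' (pow_pos (ratio_pos hx) _).ne') hc
  have hN : ((s + k).factorial * s.factorial * (b - a) ^ (s + k + s + 1) : ℝ) ≠ 0 :=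
    mul_ne_zero (by positivity) (pow_pos (sub_pos.mpr hab) _).ne'
  have key : ∀ {P Q : ℝ[X]}, IsHermiteInterpolant f a b (s + k) s P →
      IsHermiteInterpolant f a b s (s + k) Q →
      (((Even k → P.eval x = Q.eval x) ∧ (Odd k → f x = (P.eval x + Q.eval x) / 2)) ↔
        ∫ t in a..b, hermiteKernel s k a b x t * w t = 0) := by
    intro P Q hP hQ
    have h := hermite_error_sub_error_eq hf hfw hw hP hQ hx
    have h1 : (∫ t in a..b, hermiteKernel s k a b x t * w t = 0) ↔
        (f x - P.eval x) - (-1) ^ k * (f x - Q.eval x) = 0 := by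
      constructor
      · intro h0
        rw [h0, mul_zero] at h
        exact (mul_eq_zero.mp ((mul_eq_zero.mp h).resolve_left hN)).resolve_left
          (pow_ne_zero _ (by norm_num))
      · intro h0
        rw [h0, mul_zero, mul_zero] at h
        exact (mul_eq_zero.mp h.symm).resolve_left hM
    rw [h1]
    rcases Nat.even_or_odd k with hk | hk
    · simp only [hk, Nat.not_odd_iff_even.mpr hk, hk.neg_one_pow, true_imp_iff, false_imp_iff,
        and_true]
      constructor <;> intro h <;> linarith
    · simp only [hk, Nat.not_even_iff_odd.mpr hk, hk.neg_one_pow, true_imp_iff, false_imp_iff,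
        true_and]
      constructor <;> intro h <;> linarith
  constructor
  · rintro ⟨P, Q, hP, hQ, h⟩
    exact (key hP hQ).mp h
  · intro h
    obtain ⟨P, hP⟩ := exists_isHermiteInterpolant f hab.ne (s + k) s
    obtain ⟨Q, hQ⟩ := exists_isHermiteInterpolant f hab.ne s (s + k)
    exact ⟨P, Q, hP, hQ, (key hP hQ).mpr h⟩

/-! ### Existence, uniqueness and comparison of the mean points. -/

theorem existsUnique_isHermiteMeanPoint {f w : ℝ → ℝ} {a b c : ℝ} {s k : ℕ} (hk : k ≠ 0)
    (hab : a < b) (hc : c ≠ 0) (hf : ∀ t ∈ Set.Icc a b, AnalyticAt ℝ f t)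
    (hfw : ∀ t ∈ Set.Icc a b, iteratedDeriv (s + k + s + 1 + 1) f t = c * w t)
    (hw : ContinuousOn w (Set.Icc a b)) (hpos : ∀ t ∈ Set.Icc a b, 0 < w t) :
    ∃! x, IsHermiteMeanPoint f (s + k) s a b x := by
  simp only [isHermiteMeanPoint_iff hab hc hf hfw hw]
  have hmono := strictMonoOn_integral_hermiteKernel (s := s) hk hw hpos
  -- Continuity in `x` is read off the error identity: for fixed interpolants the integral is a
  -- quotient of continuous functions with nonvanishing denominator.
  have hcont : ContinuousOn (fun x => ∫ t in a..b, hermiteKernel s k a b x t * w t)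
      (Set.Ioo a b) := by
    obtain ⟨P, hP⟩ := exists_isHermiteInterpolant f hab.ne (s + k) s
    obtain ⟨Q, hQ⟩ := exists_isHermiteInterpolant f hab.ne s (s + k)
    have hM : ∀ x ∈ Set.Ioo a b,
        (b - x) ^ (s + k + s + 1) * ((x - a) / (b - x)) ^ (s + 1) * c ≠ 0 := fun x hx =>
      mul_ne_zero (mul_ne_zero (pow_pos (sub_pos.mpr hx.2) _).ne'
        (pow_pos (ratio_pos hx) _).ne') hc
    have hfc : ContinuousOn f (Set.Ioo a b) := fun t ht =>
      (hf t (Set.Ioo_subset_Icc_self ht)).continuousAt.continuousWithinAt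
    have hnum : ContinuousOn (fun x => (s + k).factorial * s.factorial *
        (b - a) ^ (s + k + s + 1) *
        ((-1) ^ (s + 1) * ((f x - P.eval x) - (-1) ^ k * (f x - Q.eval x)))) (Set.Ioo a b) :=
      continuousOn_const.mul (continuousOn_const.mul
        ((hfc.sub P.continuous.continuousOn).sub
          (continuousOn_const.mul (hfc.sub Q.continuous.continuousOn))))
    have hden : ContinuousOn
        (fun x => (b - x) ^ (s + k + s + 1) * ((x - a) / (b - x)) ^ (s + 1) * c)
        (Set.Ioo a b) := by
      refine ContinuousOn.mul (ContinuousOn.mul (by fun_prop) (ContinuousOn.pow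
        (ContinuousOn.div (by fun_prop) (by fun_prop) fun x hx => ?_) _)) continuousOn_const
      exact (sub_pos.mpr hx.2).ne'
    refine (hnum.div hden hM).congr fun x hx => ?_
    rw [Pi.div_apply, eq_div_iff (hM x hx), hermite_error_sub_error_eq hf hfw hw hP hQ hx]
    ring
  obtain ⟨x₁, hx₁, h₁⟩ := exists_integral_hermiteKernel_neg (s := s) hk hab hw hpos
  obtain ⟨x₂, hx₂, h₂⟩ := exists_integral_hermiteKernel_pos (s := s) hk hab hw hpos
  obtain ⟨x, hx, h0⟩ := isPreconnected_Ioo.intermediate_value hx₁ hx₂ hcont ⟨h₁.le, h₂.le⟩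
  exact ⟨x, ⟨hx, h0⟩, fun y hy => hmono.injOn hy.1 hx (hy.2.trans h0.symm)⟩

theorem continuousOn_rpow_Icc (p : ℝ) {a b : ℝ} (ha : 0 < a) :
    ContinuousOn (fun t : ℝ => t ^ p) (Set.Icc a b) := fun _ ht =>
  (analyticAt_rpow_const p (ha.trans_le ht.1)).continuousAt.continuousWithinAt

theorem existsUnique_powerMean_point (p : ℝ) {s k : ℕ} (hk : k ≠ 0) {a b : ℝ} (ha : 0 < a)
    (hab : a < b) :
    ∃! x, IsHermiteMeanPoint (powerGenerator (s + k + s + 1) p) (s + k) s a b x := by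
  obtain ⟨c, hc, h⟩ := exists_iteratedDeriv_powerGenerator (s + k + s + 1) p
  exact existsUnique_isHermiteMeanPoint hk hab hc
    (fun t ht => analyticAt_powerGenerator _ p (ha.trans_le ht.1))
    (fun t ht => h t (ha.trans_le ht.1)) (continuousOn_rpow_Icc _ ha)
    (fun t ht => Real.rpow_pos_of_pos (ha.trans_le ht.1) _)

theorem powerMean_point_lt {p q : ℝ} (hpq : p < q) {s k : ℕ} (hk : k ≠ 0) {a b x y : ℝ}
    (ha : 0 < a) (hab : a < b)
    (hx : IsHermiteMeanPoint (powerGenerator (s + k + s + 1) p) (s + k) s a b x)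
    (hy : IsHermiteMeanPoint (powerGenerator (s + k + s + 1) q) (s + k) s a b y) : x < y := by
  have key : ∀ {p x : ℝ},
      IsHermiteMeanPoint (powerGenerator (s + k + s + 1) p) (s + k) s a b x →
      x ∈ Set.Ioo a b ∧ ∫ t in a..b, hermiteKernel s k a b x t *
        t ^ (p - ((s + k + s + 1 : ℕ) + 1)) = 0 := by
    intro p x hx
    obtain ⟨c, hc, h⟩ := exists_iteratedDeriv_powerGenerator (s + k + s + 1) p
    exact (isHermiteMeanPoint_iff hab hc
      (fun t ht => analyticAt_powerGenerator _ p (ha.trans_le ht.1))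
      (fun t ht => h t (ha.trans_le ht.1)) (continuousOn_rpow_Icc _ ha)).mp hx
  obtain ⟨hx, hx0⟩ := key hx
  obtain ⟨hy, hy0⟩ := key hy
  -- The increasing factor is `t^(q-p)`, which converts the weight for `p` into the weight for `q`.
  have hneg := integral_hermiteKernel_mul_neg hk hx (continuousOn_rpow_Icc _ ha)
    (fun t ht => Real.rpow_pos_of_pos (ha.trans_le ht.1) _)
    (continuousOn_rpow_Icc (q - p) ha)
    (fun t ht u _ htu => Real.rpow_lt_rpow (ha.trans_le ht.1).le htu (sub_pos.mpr hpq)) hx0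
  have heq : ∫ t in a..b, hermiteKernel s k a b x t *
        (t ^ (p - ((s + k + s + 1 : ℕ) + 1)) * t ^ (q - p)) =
      ∫ t in a..b, hermiteKernel s k a b x t * t ^ (q - ((s + k + s + 1 : ℕ) + 1)) := by
    refine intervalIntegral.integral_congr fun t ht => ?_
    rw [Set.uIcc_of_le hab.le] at ht
    rw [← Real.rpow_add (ha.trans_le ht.1)]
    congr 2
    ring
  -- The integral with the weight for `q` is negative at `x` and zero at `y`, and it is strictly
  -- increasing.
  rw [heq, ← hy0] at hneg
  exact (strictMonoOn_integral_hermiteKernel hk (continuousOn_rpow_Icc _ ha)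
    (fun t ht => Real.rpow_pos_of_pos (ha.trans_le ht.1) _)).lt_iff_lt hx hy |>.mp hneg

theorem theorem10 (m₁ m₂ : ℕ) (hm : m₂ < m₁) (a b : ℝ) (ha : 0 < a) (hb : 0 < b) :
    Monotone (fun p : ℝ => powerMean p m₁ m₂ a b) ∧
    (a ≠ b →
      (∀ p : ℝ, ∃! x : ℝ,
        IsHermiteMeanPoint (powerGenerator (m₁ + m₂ + 1) p) m₁ m₂ a b x) ∧
      StrictMono (fun p : ℝ => powerMean p m₁ m₂ a b)) := by
  obtain ⟨k, rfl⟩ := Nat.exists_eq_add_of_le hm.le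
  have hk : k ≠ 0 := by omega
  have main : a ≠ b →
      (∀ p : ℝ, ∃! x : ℝ,
        IsHermiteMeanPoint (powerGenerator (m₂ + k + m₂ + 1) p) (m₂ + k) m₂ a b x) ∧
      StrictMono (fun p : ℝ => powerMean p (m₂ + k) m₂ a b) := by
    intro hab
    have hex : ∀ p : ℝ, ∃! x : ℝ,
        IsHermiteMeanPoint (powerGenerator (m₂ + k + m₂ + 1) p) (m₂ + k) m₂ a b x := by
      intro p
      rcases hab.lt_or_gt with h | h
      · exact existsUnique_powerMean_point p hk ha h
      · simp only [isHermiteMeanPoint_comm (a := a)]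
        exact existsUnique_powerMean_point p hk hb h
    have hspec : ∀ p : ℝ, IsHermiteMeanPoint (powerGenerator (m₂ + k + m₂ + 1) p) (m₂ + k) m₂ a b
        (powerMean p (m₂ + k) m₂ a b) := by
      intro p
      rw [powerMean, hermiteMean, if_neg hab]
      exact Classical.epsilon_spec (hex p).exists
    refine ⟨hex, fun p q hpq => ?_⟩
    rcases hab.lt_or_gt with h | h
    · exact powerMean_point_lt hpq hk ha h (hspec p) (hspec q)
    · exact powerMean_point_lt hpq hk hb h (hspec p).symm (hspec q).symm
  refine ⟨?_, main⟩
  rcases eq_or_ne a b with rfl | hab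
  · intro p q _
    simp [powerMean, hermiteMean]
  · exact (main hab).2.monotone
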